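/- Let $K$ be a field, $n\ge 4$, and $R=K[x_1,\dots,x_n]$. For a partition $\lambda$ of $n$ let $\operatorname{Tab}(\lambda)$ be the set of bijective fillings of the Young diagram of $\lambda$ by $1,\dots,n$. For $T\in\operatorname{Tab}(\lambda)$ let $\{T\}$ be its tabloid (class under row equivalence), let $$e(T)=\sum_{\pi\in C(T)}\operatorname{sgn}(\pi)\,\{\pi T\}$$ be its polytabloid, where $C(T)$ is the group of permutations of $\{1,\dots,n\}$ preserving each column of $T$, and let $V_\lambda$ be the Specht module, i.e. the $K$-span of all $e(T)$, $T\in\operatorname{Tab}(\lambda)$, in the $K$-vector space with basis the tabloids of shape $\lambda$. (i) There is a unique $R$-linear map $\partial_1\colon V_{(n-2,2)}\otimes_K R\to R$ such that $\partial_1(e(T)\otimes 1)=f_T$ for all $T\in\operatorname{Tab}(n-2,2)$. Here $f_T$ is the Specht polynomial of $T$, the product of $x_a-x_b$ over all pairs of entries $a,b$ of $T$ in the same column with $a$ above $b$. (ii) Let $2\le i\le n-3$. For $T\in\operatorname{Tab}(n-1-i,2,1^{i-1})$ with first column $a_1,\dots,a_{i+1}$ (from top to bottom) and $1\le j\le i+1$,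 let $T_j\in\operatorname{Tab}(n-i,2,1^{i-2})$ be the tableau obtained from $T$ by removing $a_j$ from the first column, moving up by one row the entries below it in that column, and appending $a_j$ at the right end of the first row. Then there is a unique $R$-linear map $$\partial_i\colon V_{(n-1-i,2,1^{i-1})}\otimes_K R\to V_{(n-i,2,1^{i-2})}\otimes_K R$$ such that $$\partial_i(e(T)\otimes 1)=\sum_{j=1}^{i+1}(-1)^{j-1}\,e(T_j)\otimes x_{a_j}\qquad\text{for all } T\in\operatorname{Tab}(n-1-i,2,1^{i-1}).$$ In other words, the maps $\partial_i$ ($1\le i\le n-3$) defined on polytabloids by these formulas are well-defined: they respect all linear relations among polytabloids. -/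

import Mathlib

open scoped TensorProduct

noncomputable section

namespace Specht

/-- A Young tableau of shape `μ`: a bijective filling of the cells of the Young diagram `μ`
(cells are pairs (row, column), counted from `0`) by the `n` numbers in `Fin n`. -/
abbrev Tableau (μ : YoungDiagram) (n : ℕ) : Type := μ.cells ≃ Fin n

namespace Tableau

variable {μ : YoungDiagram} {n : ℕ}

/-- The row of `T` that contains the number `k`. -/
def rowOf (T : Tableau μ n) (k : Fin n) : ℕ := (T.symm k).1.1

/-- The column of `T` that contains the number `k`. -/
def colOf (T : Tableau μ n) (k : Fin n) : ℕ := (T.symm k).1.2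

/-- The tableau `σ T`, obtained by replacing each entry `k` of `T` by `σ k`. -/
def perm (σ : Equiv.Perm (Fin n)) (T : Tableau μ n) : Tableau μ n := T.trans σ

/-- Row equivalence: corresponding rows of the two tableaux contain the same numbers. -/
def rowSetoid (μ : YoungDiagram) (n : ℕ) : Setoid (Tableau μ n) where
  r T T' := ∀ k, T.rowOf k = T'.rowOf k
  iseqv := ⟨fun _ _ => rfl, fun h k => (h k).symm, fun h h' k => (h k).trans (h' k)⟩

/-- The column stabilizer `C(T)`: the permutations that map every column of `T` to itself. -/
def colStabilizer (T : Tableau μ n) : Finset (Equiv.Perm (Fin n)) :=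
  Finset.univ.filter fun π => ∀ k, T.colOf (π k) = T.colOf k

end Tableau

/-- Tabloids of shape `μ`: row equivalence classes of tableaux. -/
abbrev Tabloid (μ : YoungDiagram) (n : ℕ) : Type := Quotient (Tableau.rowSetoid μ n)

section Module

variable (K : Type*) [Field K] {μ : YoungDiagram} {n : ℕ}

/-- The polytabloid `∑_{π ∈ C(T)} sgn(π) {π T}`, in the vector space with basis the tabloids. -/
def polytabloid (T : Tableau μ n) : Tabloid μ n →₀ K :=
  ∑ π ∈ T.colStabilizer,
    Finsupp.single (Quotient.mk (Tableau.rowSetoid μ n) (T.perm π)) ((Equiv.Perm.sign π : ℤ) : K)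

variable (μ n)

/-- The Specht module `V_μ`: the span of all polytabloids of shape `μ`. -/
def spechtModule : Submodule K (Tabloid μ n →₀ K) :=
  Submodule.span K (Set.range fun T : Tableau μ n => polytabloid K T)

variable {μ n}

/-- The polytabloid `e(T)` as an element of the Specht module. -/
def e (T : Tableau μ n) : spechtModule K μ n :=
  ⟨polytabloid K T, Submodule.subset_span ⟨T, rfl⟩⟩

/-- The Specht polynomial `f_T`: the product of `x_{T p} - x_{T q}` over all pairs of cells
`p`, `q` in the same column with `p` above `q`. -/
def spechtPolynomial (T : Tableau μ n) : MvPolynomial (Fin n) K :=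
  ∏ p : μ.cells, ∏ q ∈ Finset.univ.filter fun q : μ.cells => p.1.2 = q.1.2 ∧ p.1.1 < q.1.1,
    (MvPolynomial.X (T p) - MvPolynomial.X (T q))

variable (μ n)

/-- The free module `V_μ ⊗_K R` over the polynomial ring `R = K[x_1, …, x_n]`. The factors are
written in the order `R ⊗ V_μ`, so that Mathlib's `R`-module structure is the intended one. -/
abbrev freeModule : Type _ := MvPolynomial (Fin n) K ⊗[K] spechtModule K μ n

end Module

/-- The partition `(n-1-i, 2, 1^{i-1})`, for `i ≤ n-3`, as a Young diagram. -/
def shape (n i : ℕ) (h : i + 3 ≤ n) : YoungDiagram :=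
  YoungDiagram.ofRowLens ((n - 1 - i) :: 2 :: List.replicate (i - 1) 1) (by
    rw [List.sortedGE_iff_pairwise]
    simp only [List.pairwise_cons, List.mem_cons, List.mem_replicate, List.pairwise_replicate]
    refine ⟨?_, ?_, ?_⟩
    · rintro a (rfl | ⟨_, rfl⟩) <;> omega
    · rintro a ⟨_, rfl⟩
      omega
    · right
      exact le_refl _)

theorem mem_shape {n i : ℕ} (h : i + 3 ≤ n) (hi : 1 ≤ i) (r c : ℕ) :
    (r, c) ∈ (shape n i h).cells ↔
      (r = 0 ∧ c < n - 1 - i) ∨ (r = 1 ∧ c < 2) ∨ (2 ≤ r ∧ r ≤ i ∧ c = 0) := by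
  rw [YoungDiagram.mem_cells, shape, YoungDiagram.mem_ofRowLens]
  rcases r with _ | _ | r
  · simp
  · simp
  · simp
    omega

/-- The cell `(j, 0)` in the first column of the diagram `(n-1-i, 2, 1^{i-1})`, `0 ≤ j ≤ i`. -/
def firstColCell {n i : ℕ} (h : i + 3 ≤ n) (hi : 1 ≤ i) (j : Fin (i + 1)) :
    (shape n i h).cells :=
  ⟨(j, 0), by rw [mem_shape h hi]; omega⟩

/-- The bijection from the cells of `(n-i, 2, 1^{i-2})` to the cells of `(n-1-i, 2, 1^{i-1})` that
sends the last cell `(0, n-1-i)` of the first row to the cell `(j, 0)`, shifts the cells of the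
first column from row `j` on down by one, and fixes the other cells. -/
def moveCell {n i : ℕ} (h : i + 3 ≤ n) (hi : 2 ≤ i) (j : Fin (i + 1)) :
    (shape n (i - 1) (by omega)).cells ≃ (shape n i h).cells where
  toFun p :=
    ⟨if p.1.2 = 0 then (if p.1.1 < j then p.1 else (p.1.1 + 1, 0))
      else if p.1 = (0, n - 1 - i) then ((j : ℕ), 0) else p.1, by
      obtain ⟨⟨r, c⟩, hp⟩ := p
      have hj := j.2
      rw [mem_shape (by omega) (by omega)] at hp
      simp only [Prod.mk.injEq]
      split_ifs <;> rw [mem_shape h (by omega)] <;> omega⟩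
  invFun q :=
    ⟨if q.1.2 = 0 then
        (if q.1.1 < j then q.1 else if q.1.1 = j then (0, n - 1 - i) else (q.1.1 - 1, 0))
      else q.1, by
      obtain ⟨⟨r, c⟩, hq⟩ := q
      have hj := j.2
      rw [mem_shape h (by omega)] at hq
      dsimp only
      split_ifs <;> rw [mem_shape (by omega) (by omega)] <;> omega⟩
  left_inv p := by
    obtain ⟨⟨r, c⟩, hp⟩ := p
    have hj := j.2
    rw [mem_shape (by omega) (by omega)] at hp
    apply Subtype.ext
    simp only [Prod.mk.injEq]
    split_ifs <;> simp_all <;> omega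
  right_inv q := by
    obtain ⟨⟨r, c⟩, hq⟩ := q
    have hj := j.2
    rw [mem_shape h (by omega)] at hq
    apply Subtype.ext
    simp only [Prod.mk.injEq]
    split_ifs <;> simp_all <;> omega

/-- The tableau `T_j`: the entry of `T` in row `j` of the first column is removed from that column
(the entries below it move up) and appended at the end of the first row. -/
def moveEntry {n i : ℕ} (h : i + 3 ≤ n) (hi : 2 ≤ i) (T : Tableau (shape n i h) n)
    (j : Fin (i + 1)) : Tableau (shape n (i - 1) (by omega)) n :=
  (moveCell h hi j).trans T

/-- The value prescribed for `∂_i (e(T) ⊗ 1)`, `2 ≤ i ≤ n-3`: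
the sum of `(-1)^j e(T_j) ⊗ x_{a_j}`, where `a_0, …, a_i` is the first column of `T`. -/
def boundary (K : Type*) [Field K] {n i : ℕ} (h : i + 3 ≤ n) (hi : 2 ≤ i)
    (T : Tableau (shape n i h) n) : freeModule K (shape n (i - 1) (by omega)) n :=
  ∑ j : Fin (i + 1), (-1 : MvPolynomial (Fin n) K) ^ (j : ℕ) •
    (MvPolynomial.X (T (firstColCell h (by omega) j)) ⊗ₜ[K] e K (moveEntry h hi T j))

end Specht

end

open scoped TensorProduct

namespace Specht

/-! ### Reduction to `K`-linear maps on the Specht module -/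

section General

variable {K : Type*} [Field K] {μ : YoungDiagram} {n : ℕ}

/-! No relations among polytabloids are needed: each prescribed formula is the restriction of a map
defined freely on all tabloids. For shape `(n-2, 2)`, send a tabloid to the product of its
second-row variables; alternating over the column group gives the expanded Specht polynomial
(`secondRowMonomial_polytabloid`).

For `i ≥ 2` the bottom row holds a single entry `a`, so `{T} ↦ x_a ⊗ {T with a moved to the first
row}` is well defined. On `e(T)`, split `C(T)` by the entry `a_j` that `π` brings to the bottom:
these `π` are the products `τ c_j`, with `τ ∈ C(T_j)` and `c_j` a cycle of sign `(-1)^(i+j)`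
(`sum_colStabilizer`, `sign_moveCycle`). The result is `(-1)^i` times the boundary
(`tabloidBoundary_polytabloid`). Tensoring `V ⊆ M` (all tabloids) with `R` stays injective, so the
values pull back to `R ⊗ V`. Uniqueness holds because polytabloids span. -/

theorem span_range_e : Submodule.span K (Set.range fun T : Tableau μ n => e K T) = ⊤ := by
  have hr : (Set.range fun T : Tableau μ n => e K T) =
      ((↑) : spechtModule K μ n → Tabloid μ n →₀ K) ⁻¹'
        Set.range fun T : Tableau μ n => polytabloid K T := by
    ext v
    simp [e, Subtype.ext_iff]
  rw [hr]
  exact Submodule.span_span_coe_preimage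

/-- An `R`-linear map on `V_μ ⊗ R` with prescribed values on polytabloids is unique, and it exists
as soon as the values come from a `K`-linear map on `V_μ`. -/
theorem existsUnique_freeModule_hom {N : Type*} [AddCommGroup N] [Module K N]
    [Module (MvPolynomial (Fin n) K) N] [IsScalarTower K (MvPolynomial (Fin n) K) N]
    (g : Tableau μ n → N) (G : spechtModule K μ n →ₗ[K] N) (hG : ∀ T, G (e K T) = g T) :
    ∃! d : freeModule K μ n →ₗ[MvPolynomial (Fin n) K] N,
      ∀ T : Tableau μ n, d (1 ⊗ₜ[K] e K T) = g T := by
  refine ⟨G.liftBaseChange (MvPolynomial (Fin n) K), fun T => by simp [hG], fun d hd => ?_⟩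
  have hspan : (d.restrictScalars K) ∘ₗ TensorProduct.mk K _ _ 1 = G := by
    refine LinearMap.ext_on_range span_range_e fun T => ?_
    simpa [hG] using hd T
  refine TensorProduct.AlgebraTensorModule.ext fun r v => ?_
  have hr : (r ⊗ₜ[K] v : freeModule K μ n) = r • (1 ⊗ₜ[K] v) := by
    rw [TensorProduct.smul_tmul', smul_eq_mul, mul_one]
  rw [hr, map_smul, map_smul, ← hspan]
  simp

theorem map_polytabloid {N : Type*} [AddCommGroup N] [Module K N] (F : Tabloid μ n → N)
    (T : Tableau μ n) :
    Finsupp.linearCombination K F (polytabloid K T) =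
      ∑ π ∈ T.colStabilizer,
        ((Equiv.Perm.sign π : ℤ) : K) • F (Quotient.mk (Tableau.rowSetoid μ n) (T.perm π)) := by
  simp [polytabloid, map_sum, Finsupp.linearCombination_single]

theorem Tableau.colOf_apply (T : Tableau μ n) (p : μ.cells) : T.colOf (T p) = p.1.2 := by
  simp [Tableau.colOf]

theorem Tableau.rowOf_apply (T : Tableau μ n) (p : μ.cells) : T.rowOf (T p) = p.1.1 := by
  simp [Tableau.rowOf]

theorem Tableau.mem_colStabilizer {T : Tableau μ n} {π : Equiv.Perm (Fin n)} :
    π ∈ T.colStabilizer ↔ ∀ k, T.colOf (π k) = T.colOf k := by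
  simp [Tableau.colStabilizer]

theorem Tableau.prod_rowOf_eq {M : Type*} [CommMonoid M] (T : Tableau μ n) (r : ℕ)
    (f : Fin n → M) :
    ∏ k with T.rowOf k = r, f k = ∏ p : μ.cells with p.1.1 = r, f (T p) := by
  rw [Finset.prod_filter, Finset.prod_filter, ← Equiv.prod_comp T]
  simp [Tableau.rowOf_apply]

end General

/-! ### The map `∂_1`: shape `(n-2, 2)` -/

section TwoRows

variable {n : ℕ} (h : 1 + 3 ≤ n)

/-- The cell in row `r` and column `c` of the diagram `(n-2, 2)`, for `r, c ≤ 1`. -/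
def squareCell (r c : Fin 2) : (shape n 1 h).cells :=
  ⟨(r, c), by rw [mem_shape h le_rfl]; omega⟩

theorem squareCell_inj {r c r' c' : Fin 2} :
    squareCell h r c = squareCell h r' c' ↔ r = r' ∧ c = c' := by
  simp [squareCell, Fin.ext_iff]

theorem eq_squareCell_or {p q : (shape n 1 h).cells} (hpq : p.1.2 = q.1.2) :
    p = q ∨ ∃ c, (p = squareCell h 0 c ∧ q = squareCell h 1 c) ∨
      (p = squareCell h 1 c ∧ q = squareCell h 0 c) := by
  obtain ⟨⟨r, c⟩, hp⟩ := p
  obtain ⟨⟨r', c'⟩, hq⟩ := q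
  rw [mem_shape h le_rfl] at hp hq
  dsimp only at hpq
  subst hpq
  by_cases hr : r = r'
  · left
    simp [hr]
  · right
    refine ⟨⟨c, by omega⟩, ?_⟩
    simp only [squareCell, Subtype.mk.injEq, Prod.mk.injEq, Fin.val_zero, Fin.val_one,
      and_true]
    omega

theorem prod_secondRow {M : Type*} [CommMonoid M] (f : (shape n 1 h).cells → M) :
    ∏ p : (shape n 1 h).cells with p.1.1 = 1, f p =
      f (squareCell h 1 0) * f (squareCell h 1 1) := by
  have hs : (Finset.univ.filter fun p : (shape n 1 h).cells => p.1.1 = 1) =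
      {squareCell h 1 0, squareCell h 1 1} := by
    ext ⟨⟨r, c⟩, hp⟩
    rw [mem_shape h le_rfl] at hp
    simp only [squareCell, Finset.mem_filter, Finset.mem_univ, true_and, Finset.mem_insert,
      Finset.mem_singleton, Subtype.mk.injEq, Prod.mk.injEq, Fin.val_zero, Fin.val_one]
    omega
  rw [hs, Finset.prod_pair (by simp [squareCell_inj])]

theorem spechtPolynomial_twoRows (K : Type*) [Field K] (T : Tableau (shape n 1 h) n) :
    spechtPolynomial K T =
      (MvPolynomial.X (T (squareCell h 0 0)) - MvPolynomial.X (T (squareCell h 1 0))) *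
        (MvPolynomial.X (T (squareCell h 0 1)) - MvPolynomial.X (T (squareCell h 1 1))) := by
  have hne : squareCell h 0 0 ≠ squareCell h 0 1 := by simp [squareCell_inj]
  have hcol : ∀ c : Fin 2, (Finset.univ.filter fun q : (shape n 1 h).cells =>
      (squareCell h 0 c).1.2 = q.1.2 ∧ (squareCell h 0 c).1.1 < q.1.1) = {squareCell h 1 c} := by
    intro c
    refine Finset.ext fun q => ?_
    rw [Finset.mem_filter, Finset.mem_singleton]
    obtain ⟨⟨r, c'⟩, hq⟩ := q
    rw [mem_shape h le_rfl] at hq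
    simp only [squareCell, Finset.mem_univ, true_and, Subtype.mk.injEq, Prod.mk.injEq,
      Fin.val_zero, Fin.val_one]
    omega
  rw [spechtPolynomial,
    ← Finset.prod_subset (Finset.subset_univ {squareCell h 0 0, squareCell h 0 1})]
  · rw [Finset.prod_pair hne, hcol, hcol, Finset.prod_singleton, Finset.prod_singleton]
  -- Any other cell has no cell below it, so its inner product is empty.
  · intro p _ hp
    refine Finset.prod_eq_one fun q hq => ?_
    simp only [Finset.mem_filter, Finset.mem_univ, true_and] at hq
    exfalso
    rcases eq_squareCell_or h hq.1 with rfl | ⟨c, ⟨rfl, rfl⟩ | ⟨rfl, rfl⟩⟩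
    · omega
    · fin_cases c <;> simp at hp
    · simp [squareCell] at hq

/-- Only the first two columns have two cells, so the group is generated by their two commuting
transpositions. -/
theorem colStabilizer_twoRows (T : Tableau (shape n 1 h) n) :
    T.colStabilizer =
      {1, Equiv.swap (T (squareCell h 0 0)) (T (squareCell h 1 0)),
        Equiv.swap (T (squareCell h 0 1)) (T (squareCell h 1 1)),
        Equiv.swap (T (squareCell h 0 0)) (T (squareCell h 1 0)) *
          Equiv.swap (T (squareCell h 0 1)) (T (squareCell h 1 1))} := by
  ext π
  simp only [Tableau.mem_colStabilizer, Finset.mem_insert, Finset.mem_singleton]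
  constructor
  · intro H
    have hor : ∀ p : (shape n 1 h).cells, π (T p) = T p ∨
        ∃ c, (π (T p) = T (squareCell h 0 c) ∧ p = squareCell h 1 c) ∨
          (π (T p) = T (squareCell h 1 c) ∧ p = squareCell h 0 c) := by
      intro p
      obtain ⟨q, hq⟩ := T.surjective (π (T p))
      have hc := H (T p)
      rw [← hq, T.colOf_apply, T.colOf_apply] at hc
      simpa [← hq] using eq_squareCell_or h hc
    have hfix : ∀ p : (shape n 1 h).cells, (∀ r c, p ≠ squareCell h r c) → π (T p) = T p := by
      intro p hp
      rcases hor p with hp' | ⟨c, ⟨-, hp'⟩ | ⟨-, hp'⟩⟩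
      · exact hp'
      · exact absurd hp' (hp _ _)
      · exact absurd hp' (hp _ _)
    have hcol : ∀ c, (π (T (squareCell h 0 c)) = T (squareCell h 0 c) ∧
        π (T (squareCell h 1 c)) = T (squareCell h 1 c)) ∨
        (π (T (squareCell h 0 c)) = T (squareCell h 1 c) ∧
        π (T (squareCell h 1 c)) = T (squareCell h 0 c)) := by
      intro c
      have hinj : π (T (squareCell h 0 c)) ≠ π (T (squareCell h 1 c)) := by
        simp [squareCell_inj]
      have h0 := hor (squareCell h 0 c)
      have h1 := hor (squareCell h 1 c)
      simp only [squareCell_inj, zero_ne_one, one_ne_zero, false_and, and_false, true_and,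
        exists_eq_right', false_or, or_false] at h0 h1
      rcases h0 with h0 | h0 <;> rcases h1 with h1 | h1
      · exact Or.inl ⟨h0, h1⟩
      · exact absurd (h0.trans h1.symm) hinj
      · exact absurd (h0.trans h1.symm) hinj
      · exact Or.inr ⟨h0, h1⟩
    have hext : ∀ σ : Equiv.Perm (Fin n),
        (∀ r c, π (T (squareCell h r c)) = σ (T (squareCell h r c))) →
        (∀ p : (shape n 1 h).cells, (∀ r c, p ≠ squareCell h r c) → σ (T p) = T p) → π = σ := by
      intro σ h1 h2
      ext1 k
      obtain ⟨p, rfl⟩ := T.surjective k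
      by_cases hp : ∃ r c, p = squareCell h r c
      · obtain ⟨r, c, rfl⟩ := hp
        exact h1 r c
      · push Not at hp
        rw [hfix p hp, h2 p hp]
    rcases hcol 0 with ⟨h00, h10⟩ | ⟨h00, h10⟩ <;> rcases hcol 1 with ⟨h01, h11⟩ | ⟨h01, h11⟩
    · left
      refine hext _ ?_ ?_
      · simp [Fin.forall_fin_two, *]
      · simp
    · right; right; left
      refine hext _ ?_ ?_
      · simp [Fin.forall_fin_two, Equiv.swap_apply_def, squareCell_inj, *]
      · intro p hp
        simp [Equiv.swap_apply_def, hp]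
    · right; left
      refine hext _ ?_ ?_
      · simp [Fin.forall_fin_two, Equiv.swap_apply_def, squareCell_inj, *]
      · intro p hp
        simp [Equiv.swap_apply_def, hp]
    · right; right; right
      refine hext _ ?_ ?_
      · simp [Fin.forall_fin_two, Equiv.swap_apply_def, squareCell_inj, *]
      · intro p hp
        simp [Equiv.swap_apply_def, hp]
  · have hswap : ∀ c k, T.colOf (Equiv.swap (T (squareCell h 0 c)) (T (squareCell h 1 c)) k) =
        T.colOf k := by
      intro c k
      rw [Equiv.swap_apply_def]
      split_ifs with h1 h2
      · rw [h1, T.colOf_apply, T.colOf_apply]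
        rfl
      · rw [h2, T.colOf_apply, T.colOf_apply]
        rfl
      · rfl
    rintro (rfl | rfl | rfl | rfl) k
    · rfl
    · exact hswap 0 k
    · exact hswap 1 k
    · exact (hswap 0 _).trans (hswap 1 k)

/-- The product of the variables in the second row of a tabloid of shape `(n-2, 2)`. -/
noncomputable def secondRowMonomial (K : Type*) [Field K] : Tabloid (shape n 1 h) n →
    MvPolynomial (Fin n) K :=
  Quotient.lift (fun T => ∏ k with T.rowOf k = 1, MvPolynomial.X k) fun T T' hT => by
    have hT' : ∀ k, T.rowOf k = T'.rowOf k := hT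
    simp only [hT']

theorem secondRowMonomial_mk (K : Type*) [Field K] (T : Tableau (shape n 1 h) n) :
    secondRowMonomial h K (Quotient.mk _ T) =
      MvPolynomial.X (T (squareCell h 1 0)) * MvPolynomial.X (T (squareCell h 1 1)) := by
  change ∏ k with T.rowOf k = 1, MvPolynomial.X k = _
  rw [T.prod_rowOf_eq, prod_secondRow]

theorem secondRowMonomial_polytabloid (K : Type*) [Field K] (T : Tableau (shape n 1 h) n) :
    Finsupp.linearCombination K (secondRowMonomial h K) (polytabloid K T) =
      spechtPolynomial K T := by
  have h0 : T (squareCell h 0 0) ≠ T (squareCell h 1 0) := by simp [squareCell_inj]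
  have h1 : T (squareCell h 0 1) ≠ T (squareCell h 1 1) := by simp [squareCell_inj]
  have hne : ∀ r r', T (squareCell h r 0) ≠ T (squareCell h r' 1) := by simp [squareCell_inj]
  have hne' : ∀ r r', T (squareCell h r 1) ≠ T (squareCell h r' 0) := by simp [squareCell_inj]
  have hs0 := Equiv.swap_apply_left (T (squareCell h 0 0)) (T (squareCell h 1 0))
  have hs1 := Equiv.swap_apply_left (T (squareCell h 0 1)) (T (squareCell h 1 1))
  have hf1 := Equiv.swap_apply_of_ne_of_ne (hne 0 0) (hne 0 1)
  have hf0 := Equiv.swap_apply_of_ne_of_ne (hne' 0 0) (hne' 0 1)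
  rw [map_polytabloid, colStabilizer_twoRows, Finset.sum_insert, Finset.sum_insert,
    Finset.sum_insert, Finset.sum_singleton, spechtPolynomial_twoRows]
  · simp only [secondRowMonomial_mk, Tableau.perm, Equiv.trans_apply, Equiv.Perm.mul_apply,
      Equiv.Perm.sign_mul, Equiv.Perm.sign_swap h0, Equiv.Perm.sign_swap h1,
      Equiv.swap_apply_right, Equiv.Perm.one_apply, Equiv.Perm.sign_one,
      Equiv.swap_apply_of_ne_of_ne (hne 1 0) (hne 1 1), hf0,
      Equiv.swap_apply_of_ne_of_ne (hne' 1 0) (hne' 1 1)]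
    simp
    ring
  -- The remaining goals say that the four permutations are distinct; their values on the top
  -- entries of the two columns tell them apart.
  · simp only [Finset.mem_singleton]
    intro heq
    have := congrArg (fun π => π (T (squareCell h 0 0))) heq
    simp [hf1, hs0, h0] at this
  · simp only [Finset.mem_insert, Finset.mem_singleton, not_or]
    refine ⟨fun heq => ?_, fun heq => ?_⟩
    · have := congrArg (fun π => π (T (squareCell h 0 0))) heq
      simp [hf1, hs0, h0.symm] at this
    · have := congrArg (fun π => π (T (squareCell h 0 1))) heq
      simp [hf0, hs1, Equiv.swap_apply_of_ne_of_ne (hne' 1 0) (hne' 1 1), h1] at this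
  · simp only [Finset.mem_insert, Finset.mem_singleton, not_or]
    refine ⟨fun heq => ?_, fun heq => ?_, fun heq => ?_⟩
    · have := congrArg (fun π => π (T (squareCell h 0 0))) heq
      simp [hs0, h0] at this
    · have := congrArg (fun π => π (T (squareCell h 0 1))) heq
      simp [hs1, h1] at this
    · have := congrArg (fun π => π (T (squareCell h 0 0))) heq
      simp [hf1, hs0, h0] at this

end TwoRows

/-! ### The maps `∂_i` for `i ≥ 2` -/

section Boundary

variable {n i : ℕ} (h : i + 3 ≤ n) (hi : 2 ≤ i)

/-- `T_j` and `T_{j+1}` differ only by exchanging `a_j` and `a_{j+1}`; each such step flips the sign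
of `moveCycle`. -/
theorem moveCell_succ (j : ℕ) (hj : j + 1 < i + 1) :
    moveCell h hi ⟨j + 1, hj⟩ = (moveCell h hi ⟨j, by omega⟩).trans
      (Equiv.swap (firstColCell h (by omega) ⟨j, by omega⟩)
        (firstColCell h (by omega) ⟨j + 1, hj⟩)) := by
  refine Equiv.ext fun p => Subtype.ext ?_
  obtain ⟨⟨r, c⟩, hp⟩ := p
  rw [mem_shape (by omega) (by omega)] at hp
  simp only [Equiv.trans_apply, Equiv.swap_apply_def, moveCell, firstColCell, Equiv.coe_fn_mk,
    Subtype.mk.injEq, apply_ite Subtype.val]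
  rcases Nat.eq_zero_or_pos c with rfl | hc
  · rcases lt_trichotomy r j with hr | rfl | hr
    · have h1 : r < j + 1 := by omega
      have h2 : r ≠ j := by omega
      have h3 : r ≠ j + 1 := by omega
      simp [hr, h1, h2, h3]
    · simp
    · have h1 : ¬ r < j + 1 := by omega
      have h2 : ¬ r < j := by omega
      have h3 : r + 1 ≠ j := by omega
      have h4 : r ≠ j := by omega
      simp [h1, h2, h3, h4]
  · have hc' : c ≠ 0 := by omega
    by_cases hr : r = 0 ∧ c = n - 1 - i
    · have h1 : n - 1 - i ≠ 0 := by omega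
      simp [hr.1, hr.2, h1]
    · simp [hc', hr]

/-- The permutation that carries `T_i` to `T_j`. -/
def moveCycle (T : Tableau (shape n i h) n) (j : Fin (i + 1)) : Equiv.Perm (Fin n) :=
  (moveEntry h hi T (Fin.last i)).symm.trans (moveEntry h hi T j)

theorem sign_moveCycle (T : Tableau (shape n i h) n) (j : Fin (i + 1)) :
    Equiv.Perm.sign (moveCycle h hi T j) = (-1) ^ (i + j : ℕ) := by
  obtain ⟨j, hj⟩ := j
  -- Descending induction from `j = i`, where the cycle is trivial.
  induction hd : i - j generalizing j with
  | zero =>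
    obtain rfl : j = i := by omega
    have h1 : moveCycle h hi T ⟨j, hj⟩ = 1 := Equiv.symm_trans_self _
    rw [h1, map_one, ← two_mul, pow_mul]
    simp
  | succ d ih =>
    have hj' : j + 1 < i + 1 := by omega
    have hstep : moveCycle h hi T ⟨j + 1, hj'⟩ = Equiv.swap
        (T (firstColCell h (by omega) ⟨j, hj⟩)) (T (firstColCell h (by omega) ⟨j + 1, hj'⟩)) *
          moveCycle h hi T ⟨j, hj⟩ := by
      ext1 k
      simp [moveCycle, moveEntry, moveCell_succ h hi j hj', T.injective.swap_apply]
    have hs := ih (j + 1) hj' (by omega)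
    rw [hstep, map_mul, Equiv.Perm.sign_swap] at hs
    · rw [show i + (j + 1) = (i + j) + 1 from rfl, pow_succ, mul_comm _ (-1 : ℤˣ)] at hs
      exact mul_left_cancel hs
    · simp [firstColCell]

theorem colOf_ne (hi : 2 ≤ i) (T : Tableau (shape n i h) n) (k : Fin n) :
    T.colOf k ≠ n - 1 - i := by
  obtain ⟨⟨⟨r, c⟩, hp⟩, rfl⟩ := T.surjective k
  rw [T.colOf_apply]
  rw [mem_shape h (by omega)] at hp
  dsimp only
  omega

theorem colOf_moveEntry (T : Tableau (shape n i h) n) (j : Fin (i + 1)) (k : Fin n) :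
    (moveEntry h hi T j).colOf k =
      if k = T (firstColCell h (by omega) j) then n - 1 - i else T.colOf k := by
  obtain ⟨⟨⟨r, c⟩, hp⟩, rfl⟩ := T.surjective k
  have hj := j.2
  rw [mem_shape h (by omega)] at hp
  simp only [Tableau.colOf, moveEntry, Equiv.symm_trans_apply,
    Equiv.symm_apply_apply, EmbeddingLike.apply_eq_iff_eq, moveCell, Equiv.coe_fn_symm_mk,
    firstColCell, Subtype.mk.injEq, Prod.mk.injEq]
  split_ifs <;> simp_all

/-- Removing the bottom entry shifts nothing up, so the rows of the new tableau depend only on the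
rows of `T`. This lets the move descend to tabloids. -/
theorem rowOf_moveEntry_last (T : Tableau (shape n i h) n) (k : Fin n) :
    (moveEntry h hi T (Fin.last i)).rowOf k = if T.rowOf k = i then 0 else T.rowOf k := by
  obtain ⟨⟨⟨r, c⟩, hp⟩, rfl⟩ := T.surjective k
  rw [mem_shape h (by omega)] at hp
  simp only [Tableau.rowOf, moveEntry, Equiv.symm_trans_apply,
    Equiv.symm_apply_apply, moveCell, Equiv.coe_fn_symm_mk, Fin.val_last]
  split_ifs <;> simp_all
  all_goals omega

theorem rowOf_eq_iff (T : Tableau (shape n i h) n) (k : Fin n) :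
    T.rowOf k = i ↔ k = T (firstColCell h (by omega) (Fin.last i)) := by
  obtain ⟨⟨⟨r, c⟩, hp⟩, rfl⟩ := T.surjective k
  rw [mem_shape h (by omega)] at hp
  simp only [T.rowOf_apply, EmbeddingLike.apply_eq_iff_eq, firstColCell, Subtype.mk.injEq,
    Prod.mk.injEq, Fin.val_last]
  omega

/-- In `T_j` the entry `a_j` is alone in the new column `n-1-i`, and the other columns are those of
`T` without `a_j`. -/
theorem mem_colStabilizer_moveEntry (T : Tableau (shape n i h) n) (j : Fin (i + 1))
    (τ : Equiv.Perm (Fin n)) :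
    τ ∈ (moveEntry h hi T j).colStabilizer ↔
      τ (T (firstColCell h (by omega) j)) = T (firstColCell h (by omega) j) ∧
        τ ∈ T.colStabilizer := by
  simp only [Tableau.mem_colStabilizer, colOf_moveEntry]
  have hne := colOf_ne h hi T
  constructor
  · intro H
    have hfix : τ (T (firstColCell h (by omega) j)) = T (firstColCell h (by omega) j) := by
      by_contra hcon
      have := H (T (firstColCell h (by omega) j))
      rw [if_neg hcon, if_pos rfl] at this
      exact hne _ this
    refine ⟨hfix, fun k => ?_⟩
    by_cases hk : k = T (firstColCell h (by omega) j)
    · rw [hk, hfix]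
    · have := H k
      rwa [if_neg hk, if_neg] at this
      rw [← hfix]
      exact fun hk' => hk (τ.injective hk')
  · rintro ⟨hfix, H⟩ k
    by_cases hk : k = T (firstColCell h (by omega) j)
    · rw [hk, hfix]
    · rw [if_neg hk, if_neg, H]
      rw [← hfix]
      exact fun hk' => hk (τ.injective hk')

theorem colOf_moveCycle (T : Tableau (shape n i h) n) (j : Fin (i + 1)) (k : Fin n) :
    T.colOf (moveCycle h hi T j k) = T.colOf k := by
  have hj := j.2
  obtain ⟨p, rfl⟩ := (moveEntry h hi T (Fin.last i)).surjective k
  have h1 : moveCycle h hi T j (moveEntry h hi T (Fin.last i) p) = moveEntry h hi T j p := by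
    simp [moveCycle]
  rw [h1]
  obtain ⟨⟨r, c⟩, hp⟩ := p
  simp only [moveEntry, Equiv.trans_apply, T.colOf_apply, moveCell, Equiv.coe_fn_mk]
  split_ifs <;> simp_all

theorem moveCycle_last (T : Tableau (shape n i h) n) (j : Fin (i + 1)) :
    moveCycle h hi T j (T (firstColCell h (by omega) (Fin.last i))) =
      T (firstColCell h (by omega) j) := by
  have hj := j.2
  simp only [moveCycle, moveEntry, moveCell, firstColCell, Equiv.trans_apply,
    Equiv.symm_trans_apply, Equiv.symm_apply_apply, Equiv.coe_fn_symm_mk, Equiv.coe_fn_mk,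
    EmbeddingLike.apply_eq_iff_eq, Subtype.mk.injEq, Fin.val_last]
  have : n - 1 - i ≠ 0 := by omega
  simp [this]

theorem moveEntry_last_perm_mul (T : Tableau (shape n i h) n) (j : Fin (i + 1))
    (τ : Equiv.Perm (Fin n)) :
    moveEntry h hi (T.perm (τ * moveCycle h hi T j)) (Fin.last i) =
      (moveEntry h hi T j).perm τ := by
  ext1 p
  simp [moveEntry, Tableau.perm, moveCycle]

/-- A sum over `C(T)`, split according to the image of the last entry of the first column. -/
theorem sum_colStabilizer {M : Type*} [AddCommMonoid M] (T : Tableau (shape n i h) n)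
    (f : Equiv.Perm (Fin n) → M) :
    ∑ π ∈ T.colStabilizer, f π =
      ∑ j, ∑ τ ∈ (moveEntry h hi T j).colStabilizer, f (τ * moveCycle h hi T j) := by
  rw [Finset.sum_sigma']
  symm
  refine Finset.sum_bij (fun x _ => x.2 * moveCycle h hi T x.1) ?_ ?_ ?_ fun _ _ => rfl
  · rintro ⟨j, τ⟩ hx
    simp only [Finset.mem_sigma, Finset.mem_univ, true_and, mem_colStabilizer_moveEntry] at hx
    rw [Tableau.mem_colStabilizer] at hx ⊢
    intro k
    rw [Equiv.Perm.mul_apply, hx.2, colOf_moveCycle]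
  · rintro ⟨j, τ⟩ hx ⟨j', τ'⟩ hx' heq
    simp only [Finset.mem_sigma, Finset.mem_univ, true_and, mem_colStabilizer_moveEntry] at hx hx'
    dsimp only at heq
    have hb := congrArg (fun π => π (T (firstColCell h (by omega) (Fin.last i)))) heq
    simp only [Equiv.Perm.mul_apply, moveCycle_last, hx.1, hx'.1] at hb
    have hjj : j = j' := by
      simpa [firstColCell, Fin.ext_iff] using hb
    subst hjj
    rw [mul_right_cancel heq]
  · intro π hπ
    rw [Tableau.mem_colStabilizer] at hπ
    obtain ⟨⟨⟨r, c⟩, hp⟩, hq⟩ :=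
      T.surjective (π (T (firstColCell h (by omega) (Fin.last i))))
    have hc := hπ (T (firstColCell h (by omega) (Fin.last i)))
    rw [← hq, T.colOf_apply, T.colOf_apply] at hc
    obtain rfl : c = 0 := hc
    have hr : r < i + 1 := by
      rw [mem_shape h (by omega)] at hp
      omega
    -- Here `r` is the row of the image of the bottom entry; dividing by `c_r` leaves a permutation
    -- fixing `a_r`.
    refine ⟨⟨⟨r, hr⟩, π * (moveCycle h hi T ⟨r, hr⟩)⁻¹⟩, ?_, by simp⟩
    simp only [Finset.mem_sigma, Finset.mem_univ, true_and, mem_colStabilizer_moveEntry]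
    rw [Tableau.mem_colStabilizer]
    refine ⟨?_, fun k => ?_⟩
    · rw [Equiv.Perm.mul_apply, ← moveCycle_last h hi T ⟨r, hr⟩, Equiv.Perm.inv_def,
        Equiv.symm_apply_apply, ← hq,
        moveCycle_last]
      rfl
    · rw [Equiv.Perm.mul_apply, hπ, ← colOf_moveCycle h hi T ⟨r, hr⟩, Equiv.Perm.inv_def,
        Equiv.apply_symm_apply]

/-- The tabloid `{T}` is sent to `x_a ⊗ {T_i}`, where `a` is the entry of `T` in the last row. -/
noncomputable def tabloidBoundary (K : Type*) [Field K] : Tabloid (shape n i h) n →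
    MvPolynomial (Fin n) K ⊗[K] (Tabloid (shape n (i - 1) (by omega)) n →₀ K) :=
  Quotient.lift (fun T => MvPolynomial.X (T (firstColCell h (by omega) (Fin.last i))) ⊗ₜ[K]
    Finsupp.single (Quotient.mk _ (moveEntry h hi T (Fin.last i))) 1) fun T T' hT => by
    have hT' : ∀ k, T.rowOf k = T'.rowOf k := hT
    have hlast : T (firstColCell h (by omega) (Fin.last i)) =
        T' (firstColCell h (by omega) (Fin.last i)) := by
      rw [← rowOf_eq_iff h hi, ← hT', rowOf_eq_iff h hi]
    have hmk : Quotient.mk (Tableau.rowSetoid _ n) (moveEntry h hi T (Fin.last i)) =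
        Quotient.mk _ (moveEntry h hi T' (Fin.last i)) := by
      refine Quotient.sound fun k => ?_
      rw [rowOf_moveEntry_last, rowOf_moveEntry_last, hT']
    simp only [hlast, hmk]

theorem tabloidBoundary_mk (K : Type*) [Field K] (T : Tableau (shape n i h) n) :
    tabloidBoundary h hi K (Quotient.mk _ T) =
      MvPolynomial.X (T (firstColCell h (by omega) (Fin.last i))) ⊗ₜ[K]
        Finsupp.single (Quotient.mk _ (moveEntry h hi T (Fin.last i))) 1 :=
  rfl

theorem tabloidBoundary_polytabloid (K : Type*) [Field K] (T : Tableau (shape n i h) n) :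
    (-1 : K) ^ i • Finsupp.linearCombination K (tabloidBoundary h hi K) (polytabloid K T) =
      (spechtModule K (shape n (i - 1) (by omega)) n).subtype.lTensor (MvPolynomial (Fin n) K)
        (boundary K h hi T) := by
  rw [map_polytabloid, sum_colStabilizer h hi, boundary, map_sum, Finset.smul_sum]
  refine Finset.sum_congr rfl fun j _ => ?_
  -- `lTensor` is only `K`-linear, so the sign is first rewritten as a scalar of `K`.
  have hR : (-1 : MvPolynomial (Fin n) K) ^ (j : ℕ) •
      (MvPolynomial.X (T (firstColCell h (by omega) j)) ⊗ₜ[K] e K (moveEntry h hi T j) :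
        freeModule K (shape n (i - 1) (by omega)) n) =
      (-1 : K) ^ (j : ℕ) •
        (MvPolynomial.X (T (firstColCell h (by omega) j)) ⊗ₜ[K] e K (moveEntry h hi T j)) := by
    rw [TensorProduct.smul_tmul', TensorProduct.smul_tmul',
      Algebra.smul_def ((-1 : K) ^ (j : ℕ)), map_pow, map_neg,
      map_one, smul_eq_mul]
  have he : (e K (moveEntry h hi T j) : Tabloid _ n →₀ K) =
    ∑ τ ∈ (moveEntry h hi T j).colStabilizer, Finsupp.single
      (Quotient.mk (Tableau.rowSetoid _ n) ((moveEntry h hi T j).perm τ))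
        ((Equiv.Perm.sign τ : ℤ) : K) := rfl
  rw [hR, map_smul, LinearMap.lTensor_tmul, Submodule.subtype_apply, he,
    TensorProduct.tmul_sum, Finset.smul_sum, Finset.smul_sum]
  refine Finset.sum_congr rfl fun τ hτ => ?_
  have hfix := ((mem_colStabilizer_moveEntry h hi T j τ).1 hτ).1
  rw [tabloidBoundary_mk, moveEntry_last_perm_mul, map_mul, sign_moveCycle]
  have hX : (T.perm (τ * moveCycle h hi T j)) (firstColCell h (by omega) (Fin.last i)) =
      T (firstColCell h (by omega) j) := by
    rw [Tableau.perm, Equiv.trans_apply, Equiv.Perm.mul_apply, moveCycle_last, hfix]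
  rw [hX, ← TensorProduct.tmul_smul, Finsupp.smul_single, smul_eq_mul, mul_one,
    ← TensorProduct.tmul_smul, ← TensorProduct.tmul_smul, Finsupp.smul_single,
    Finsupp.smul_single]
  congr 2
  have h2 : (-1 : K) ^ (i + i) = 1 := by rw [← two_mul, pow_mul]; simp
  simp only [smul_eq_mul]
  push_cast
  rw [pow_add] at h2 ⊢
  linear_combination (-1 : K) ^ (j : ℕ) * ((Equiv.Perm.sign τ : ℤ) : K) * h2

end Boundary

end Specht

theorem theorem4p2 (K : Type*) [Field K] (n : ℕ) :
    (∀ h : 1 + 3 ≤ n,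
      ∃! d : Specht.freeModule K (Specht.shape n 1 h) n →ₗ[MvPolynomial (Fin n) K]
          MvPolynomial (Fin n) K,
        ∀ T : Specht.Tableau (Specht.shape n 1 h) n,
          d (1 ⊗ₜ[K] Specht.e K T) = Specht.spechtPolynomial K T) ∧
    (∀ (i : ℕ) (hi : 2 ≤ i) (h : i + 3 ≤ n),
      ∃! d : Specht.freeModule K (Specht.shape n i h) n →ₗ[MvPolynomial (Fin n) K]
          Specht.freeModule K (Specht.shape n (i - 1) (by omega)) n,
        ∀ T : Specht.Tableau (Specht.shape n i h) n,
          d (1 ⊗ₜ[K] Specht.e K T) = Specht.boundary K h hi T) := by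
  constructor
  · intro h
    exact Specht.existsUnique_freeModule_hom _
      (Finsupp.linearCombination K (Specht.secondRowMonomial h K) ∘ₗ Submodule.subtype _)
      fun T => Specht.secondRowMonomial_polytabloid h K T
  · intro i hi h
    -- A merely `K`-linear retraction onto `R ⊗ V` suffices: `R`-linearity comes from the base
    -- change of a map on `V`.
    obtain ⟨g, hg⟩ := ((Specht.spechtModule K (Specht.shape n (i - 1) (by omega)) n).subtype.lTensor
      (MvPolynomial (Fin n) K)).exists_leftInverse_of_injective
        (LinearMap.ker_eq_bot.2 (Module.Flat.lTensor_preserves_injective_linearMap _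
          (Submodule.subtype_injective _)))
    refine Specht.existsUnique_freeModule_hom _ (g ∘ₗ ((-1 : K) ^ i •
      Finsupp.linearCombination K (Specht.tabloidBoundary h hi K)) ∘ₗ Submodule.subtype _)
      fun T => ?_
    have hT := congrArg g (Specht.tabloidBoundary_polytabloid h hi K T)
    exact hT.trans (LinearMap.congr_fun hg _)
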